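/- Let $R$ and $S$ be two-sided Noetherian rings and let $l\colon R\to S$ be a Frobenius extension, i.e. a unital ring homomorphism such that ${}_RS$ is a finitely generated projective left $R$-module and ${}_SS_R\cong \operatorname{Hom}_R({}_RS_S,{}_RR_R)$ as $S$-$R$-bimodules. Let $M$ be a finitely generated left $S$-module, regarded also as a left $R$-module via $l$. Then $$\operatorname{Gpd}_S(M)=\operatorname{Gpd}_R(M).$$ Here, for a ring $A$, a left $A$-module $G$ is Gorenstein projective if $G\cong\operatorname{Ker}(P^0\to P^1)$ for some exact complex $\cdots\to P^{-1}\to P^0\to P^1\to\cdots$ of projective left $A$-modules that remains exact under $\operatorname{Hom}_A(-,Q)$ for every projective left $A$-module $Q$; and the Gorenstein projective dimension $\operatorname{Gpd}_A(M)\in\{0,1,2,\dots\}\cup\{\infty\}$ is the least $n\ge 0$ for which there is an exact sequence $0\to G_n\to\cdots\to G_1\to G_0\to M\to 0$ with all $G_i$ Gorenstein projective, and $\infty$ if there is no such $n$. -/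

import Mathlib

universe u

/-- A ring extension `l : R →+* S` is a Frobenius extension if `S` is finitely generated projective
as a left `R`-module and `S ≅ Hom_R(S, R)` as `S`-`R`-bimodules.  Here `Hom_R(S, R)` consists of the
left `R`-linear maps `S → R`, with the left `S`-action `(s • f) x = f (x * s)` and the
right `R`-action `(f • r) x = f x * r`; the `R`-actions on `S` are those given by `l`. -/
def IsFrobeniusExtension {R S : Type u} [Ring R] [Ring S] (l : R →+* S) : Prop :=
  letI : Module R S := Module.compHom S l
  Module.Finite R S ∧ Module.Projective R S ∧
    ∃ e : S ≃+ (S →ₗ[R] R),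
      (∀ s t x : S, e (s * t) x = e t (x * s)) ∧
      (∀ (s : S) (r : R) (x : S), e (s * l r) x = e s x * r)

/-- A complete projective resolution over `R`: a complex `⋯ → P i → P (i + 1) → ⋯` of projective left
`R`-modules which is exact and stays exact under `Hom_R(-, Q)` for every projective left
`R`-module `Q`. -/
structure IsTotallyAcyclic (R : Type u) [Ring R] (P : ℤ → ModuleCat.{u} R)
    (d : ∀ i : ℤ, P i →ₗ[R] P (i + 1)) : Prop where
  projective : ∀ i, Module.Projective R (P i)
  exact : ∀ i, Function.Exact (d i) (d (i + 1))
  hom_exact : ∀ Q : ModuleCat.{u} R, Module.Projective R Q → ∀ i,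
    Function.Exact (fun g : P (i + 1 + 1) →ₗ[R] Q => g ∘ₗ d (i + 1))
      (fun f : P (i + 1) →ₗ[R] Q => f ∘ₗ d i)

/-- A left `R`-module is Gorenstein projective if it is isomorphic to `Ker (P 0 → P 1)` for some
complete projective resolution `P`. -/
def IsGorensteinProjective (R : Type u) [Ring R] (M : Type u) [AddCommGroup M] [Module R M] :
    Prop :=
  ∃ (P : ℤ → ModuleCat.{u} R) (d : ∀ i : ℤ, P i →ₗ[R] P (i + 1)),
    IsTotallyAcyclic R P d ∧ Nonempty (M ≃ₗ[R] LinearMap.ker (d 0))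

/-- There is an exact sequence `0 → G n → ⋯ → G 1 → G 0 → M → 0` with all `G i` Gorenstein projective
(the sequence is continued to the left by zero modules). -/
def HasGorensteinProjectiveResolution (R : Type u) [Ring R] (M : Type u) [AddCommGroup M]
    [Module R M] (n : ℕ) : Prop :=
  ∃ (G : ℕ → ModuleCat.{u} R) (d : ∀ i : ℕ, G (i + 1) →ₗ[R] G i) (ε : G 0 →ₗ[R] M),
    (∀ i, i ≤ n → IsGorensteinProjective R (G i)) ∧
    (∀ i, n < i → Subsingleton (G i)) ∧
    (∀ i, Function.Exact (d (i + 1)) (d i)) ∧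
    Function.Exact (d 0) ε ∧
    Function.Surjective ε

/-- The Gorenstein projective dimension `Gpd_R(M)`: the least length of a resolution of `M` by
Gorenstein projective modules, and `⊤` if there is no finite one. -/
noncomputable def gorensteinProjectiveDimension (R : Type u) [Ring R] (M : Type u) [AddCommGroup M]
    [Module R M] : ℕ∞ :=
  ⨅ (n : ℕ) (_ : HasGorensteinProjectiveResolution R M n), (n : ℕ∞)

/-!
Call two modules *linked*, `A → B`, if there is a short exact sequence `0 → A → P → B → 0` with `P`
projective that stays exact under `Hom(-, Q)` for projective `Q`. Cutting a complete projective
resolution into short exact sequences, and splicing them back, shows that a module is Gorenstein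
projective if and only if it belongs to a class of modules in which every member is linked to some
member and from some member (`isGorensteinProjective_of_class`). This coinductive description
replaces `Ext` throughout. It gives the closure properties needed: extensions
(`IsGorensteinProjective.of_extension`), cancellation of projective summands
(`IsGorensteinProjective.of_prod_projective`), kernels of surjections
(`IsGorensteinProjective.of_kernel`), and cokernels of `Hom`-exact embeddings into projective modules
(`IsGorensteinProjective.of_cokernel`).

A Frobenius extension `R → S` carries a form `ε : S → R` with dual bases `x`, `y`, and the Casimir
property of `∑ y i ⊗ x i` turns any `R`-linear map `k` between `S`-modules into the `S`-linear map
`a ↦ ∑ y i • k (x i • a)`. Hence coinduction `Hom_R(S, -)` preserves projective modules, and every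
projective `S`-module has an `R`-linear endomorphism whose trace is the identity.
* Links over `S` restrict to links over `R`, because maps into a projective `R`-module `Q` correspond
  to `S`-linear maps into `Hom_R(S, Q)`. So Gorenstein projective `S`-modules restrict to Gorenstein
  projective `R`-modules.
* The `S`-modules that are Gorenstein projective over `R` form a class closed under links over `S`:
  to the left take the kernel of a free presentation, to the right embed `M` in `Hom_R(S, P)` where
  `M → P` starts a complete resolution over `R`. So these modules are Gorenstein projective over `S`.

The dimensions then agree by induction on the length of a resolution, since the kernel of a
surjection from a projective module onto `M` has a resolution of length `n` when `M` has one of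
length `n + 1` (`HasGorensteinProjectiveResolution.kernel_projective`).
-/

open Function

/-! ### Gorenstein projective modules through links -/

section Basic

variable {R : Type u} [Ring R]

theorem LinearMap.exists_comp_eq_of_ker_le {A B C : Type*} [AddCommGroup A] [Module R A]
    [AddCommGroup B] [Module R B] [AddCommGroup C] [Module R C] (f : A →ₗ[R] B)
    (hf : Surjective f) (g : A →ₗ[R] C) (h : ∀ a, f a = 0 → g a = 0) :
    ∃ k : B →ₗ[R] C, ∀ a, k (f a) = g a := by
  refine ⟨(LinearMap.ker f).liftQ g (fun a ha => h a ha) ∘ₗ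
    (f.quotKerEquivOfSurjective hf).symm.toLinearMap, fun a => ?_⟩
  have : (f.quotKerEquivOfSurjective hf).symm (f a) = Submodule.Quotient.mk a := by
    rw [LinearEquiv.symm_apply_eq]; rfl
  simp only [LinearMap.comp_apply, LinearEquiv.coe_coe, this]
  rfl

theorem LinearMap.exists_comp_eq_of_forall_mem {A B C : Type*} [AddCommGroup A] [Module R A]
    [AddCommGroup B] [Module R B] [AddCommGroup C] [Module R C] (f : A →ₗ[R] B)
    (hf : Injective f) (g : C →ₗ[R] B) (h : ∀ c, ∃ a, f a = g c) :
    ∃ k : C →ₗ[R] A, ∀ c, f (k c) = g c := by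
  refine ⟨(LinearEquiv.ofInjective f hf).symm.toLinearMap ∘ₗ
    g.codRestrict (LinearMap.range f) h, fun c => ?_⟩
  have := (LinearEquiv.ofInjective f hf).apply_symm_apply (g.codRestrict (LinearMap.range f) h c)
  exact congrArg Subtype.val this

/-- Every linear map from the source of `f` to a projective module factors through `f`. -/
def LinearMap.ExtendsToProjective {A B : Type u} [AddCommGroup A] [Module R A]
    [AddCommGroup B] [Module R B] (f : A →ₗ[R] B) : Prop :=
  ∀ (Q : Type u) [AddCommGroup Q] [Module R Q] [Module.Projective R Q] (h : A →ₗ[R] Q),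
    ∃ k : B →ₗ[R] Q, ∀ a, k (f a) = h a

variable (R) in
/-- There is a short exact sequence `0 → A → P → B → 0` with `P` projective which stays exact under
`Hom(-, Q)` for every projective module `Q`. Since `Hom(-, Q)` is left exact, only the extension of
maps along `A → P` has to be required. -/
def ProjectiveLink (A B : Type u) [AddCommGroup A] [Module R A] [AddCommGroup B] [Module R B] :
    Prop :=
  ∃ (P : ModuleCat.{u} R) (f : A →ₗ[R] P) (g : P →ₗ[R] B), Module.Projective R P ∧
    Injective f ∧ Exact f g ∧ Surjective g ∧ f.ExtendsToProjective

variable {A B C E K G H M N : Type u} [AddCommGroup A] [Module R A] [AddCommGroup B] [Module R B]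
  [AddCommGroup C] [Module R C] [AddCommGroup E] [Module R E] [AddCommGroup K] [Module R K]
  [AddCommGroup G] [Module R G] [AddCommGroup H] [Module R H] [AddCommGroup M] [Module R M]
  [AddCommGroup N] [Module R N]

theorem ProjectiveLink.congr_left (h : ProjectiveLink R A B) (e : C ≃ₗ[R] A) :
    ProjectiveLink R C B := by
  obtain ⟨P, f, g, hP, hf, hfg, hg, hex⟩ := h
  refine ⟨P, f ∘ₗ e.toLinearMap, g, hP, hf.comp e.injective, fun x => ?_, hg, ?_⟩
  · rw [hfg x]
    exact ⟨fun ⟨a, ha⟩ => ⟨e.symm a, by simpa using ha⟩, fun ⟨c, hc⟩ => ⟨e c, hc⟩⟩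
  · intro Q _ _ _ h
    obtain ⟨k, hk⟩ := hex Q (h ∘ₗ e.symm.toLinearMap)
    exact ⟨k, fun c => by simpa using hk (e c)⟩

theorem ProjectiveLink.congr_right (h : ProjectiveLink R A B) (e : B ≃ₗ[R] C) :
    ProjectiveLink R A C := by
  obtain ⟨P, f, g, hP, hf, hfg, hg, hex⟩ := h
  exact ⟨P, f, e.toLinearMap ∘ₗ g, hP, hf, fun x => by simpa using hfg x,
    e.surjective.comp hg, hex⟩

theorem IsGorensteinProjective.congr (h : IsGorensteinProjective R A) (e : B ≃ₗ[R] A) :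
    IsGorensteinProjective R B := by
  obtain ⟨P, d, hP, ⟨e'⟩⟩ := h
  exact ⟨P, d, hP, ⟨e.trans e'⟩⟩

/-- The kernels of a complete projective resolution are successively linked. -/
theorem IsTotallyAcyclic.projectiveLink_ker {P : ℤ → ModuleCat.{u} R}
    {d : ∀ i : ℤ, P i →ₗ[R] P (i + 1)} (h : IsTotallyAcyclic R P d) (i : ℤ) :
    ProjectiveLink R (LinearMap.ker (d i)) (LinearMap.ker (d (i + 1))) := by
  -- exactness of the `Hom` complex has to be used one step to the left of `P i`
  obtain ⟨j, rfl⟩ : ∃ j, i = j + 1 + 1 := ⟨i - 2, by ring⟩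
  have hcomp : ∀ (k : ℤ) x, d (k + 1) (d k x) = 0 := fun k x => (h.exact k _).2 ⟨x, rfl⟩
  refine ⟨P (j + 1 + 1), (LinearMap.ker (d (j + 1 + 1))).subtype,
    (d (j + 1 + 1)).codRestrict _ (fun x => hcomp _ x), h.projective _,
    Subtype.val_injective, fun x => ?_, fun ⟨y, hy⟩ => ?_, ?_⟩
  · exact ⟨fun hx => ⟨⟨x, congrArg Subtype.val hx⟩, rfl⟩,
      fun ⟨⟨_, hy⟩, hyx⟩ => Subtype.ext (hyx ▸ hy)⟩
  · obtain ⟨x, hx⟩ := (h.exact _ y).1 hy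
    exact ⟨x, Subtype.ext hx⟩
  · intro Q _ _ _ f
    obtain ⟨g, hg⟩ := (h.hom_exact (ModuleCat.of R Q) ‹_› j
      (f ∘ₗ (d (j + 1)).codRestrict _ (fun x => hcomp _ x))).1 (by
        ext x
        have : (d (j + 1)).codRestrict (LinearMap.ker (d (j + 1 + 1))) (fun x => hcomp _ x) (d j x)
          = 0 := Subtype.ext (hcomp _ x)
        simp [this])
    refine ⟨g, fun ⟨y, hy⟩ => ?_⟩
    obtain ⟨x, rfl⟩ := (h.exact _ y).1 hy
    exact LinearMap.congr_fun hg x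

/-- Splicing a `ℤ`-indexed sequence of links gives a complete projective resolution. -/
theorem isGorensteinProjective_of_projectiveLink_int (N : ℤ → ModuleCat.{u} R)
    (h : ∀ i, ProjectiveLink R (N i) (N (i + 1))) : IsGorensteinProjective R (N 0) := by
  choose P f g hP hf hfg hg hex using h
  have h0 : ∀ i x, g i (f i x) = 0 := fun i x => (hfg i _).2 ⟨x, rfl⟩
  refine ⟨P, fun i => f (i + 1) ∘ₗ g i, ⟨hP, fun i x => ?_, fun Q hQ i φ => ?_⟩, ⟨?_⟩⟩
  · constructor
    · intro hx
      have hx' : g (i + 1) x = 0 := hf _ (by simpa using hx)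
      obtain ⟨y, rfl⟩ := (hfg _ x).1 hx'
      obtain ⟨z, rfl⟩ := hg _ y
      exact ⟨z, rfl⟩
    · rintro ⟨y, rfl⟩
      simp [h0]
  · constructor
    · intro hφ
      have hz : ∀ x, φ (f (i + 1) x) = 0 := fun x => by
        obtain ⟨y, rfl⟩ := hg _ x
        exact LinearMap.congr_fun hφ y
      obtain ⟨k, hk⟩ := LinearMap.exists_comp_eq_of_ker_le (g (i + 1)) (hg _) φ (fun x hx => by
        obtain ⟨y, rfl⟩ := (hfg _ x).1 hx
        exact hz y)
      obtain ⟨k', hk'⟩ := hex (i + 1 + 1) Q k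
      exact ⟨k', LinearMap.ext fun x => by simp [hk', hk]⟩
    · rintro ⟨ψ, rfl⟩
      ext x
      simp [h0]
  · refine LinearEquiv.ofBijective ((f 0).codRestrict _ fun x => by simp [h0])
      ⟨fun x y hxy => hf 0 (congrArg Subtype.val hxy), fun ⟨y, hy⟩ => ?_⟩
    obtain ⟨x, hx⟩ := (hfg 0 y).1 (hf _ (by simpa using hy))
    exact ⟨x, Subtype.ext hx⟩

/-- Coinduction principle: a class of modules closed under taking links in both directions
consists of Gorenstein projective modules. -/
theorem isGorensteinProjective_of_class (X : ModuleCat.{u} R → Prop)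
    (hr : ∀ A, X A → ∃ B, X B ∧ ProjectiveLink R A B)
    (hl : ∀ A, X A → ∃ B, X B ∧ ProjectiveLink R B A) (hM : X (ModuleCat.of R M)) :
    IsGorensteinProjective R M := by
  choose nr hr1 hr2 using hr
  choose nl hl1 hl2 using hl
  let a : ℕ → {A // X A} := fun n => Nat.rec ⟨_, hM⟩ (fun _ A => ⟨nr A.1 A.2, hr1 _ _⟩) n
  let b : ℕ → {A // X A} := fun n => Nat.rec ⟨_, hM⟩ (fun _ A => ⟨nl A.1 A.2, hl1 _ _⟩) n
  let N : ℤ → ModuleCat.{u} R := fun i => match i with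
    | Int.ofNat n => (a n).1
    | Int.negSucc n => (b (n + 1)).1
  refine isGorensteinProjective_of_projectiveLink_int N fun i => ?_
  match i with
  | Int.ofNat n => exact hr2 _ (a n).2
  | Int.negSucc 0 => exact hl2 _ (b 0).2
  | Int.negSucc (n + 1) => exact hl2 _ (b (n + 1)).2

theorem IsGorensteinProjective.exists_chain (h : IsGorensteinProjective R M) :
    ∃ N : ℤ → ModuleCat.{u} R, (∀ i, ProjectiveLink R (N i) (N (i + 1))) ∧
      Nonempty (M ≃ₗ[R] N 0) := by
  obtain ⟨P, d, hP, ⟨e⟩⟩ := h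
  exact ⟨fun i => ModuleCat.of R (LinearMap.ker (d i)), hP.projectiveLink_ker, ⟨e⟩⟩

theorem isGorensteinProjective_of_chain (N : ℤ → ModuleCat.{u} R)
    (h : ∀ i, ProjectiveLink R (N i) (N (i + 1))) (i : ℤ) : IsGorensteinProjective R (N i) := by
  have := isGorensteinProjective_of_projectiveLink_int (fun j => N (i + j)) (fun j => by
    have := h (i + j)
    rwa [add_assoc] at this)
  rwa [add_zero] at this

theorem IsGorensteinProjective.exists_next (h : IsGorensteinProjective R M) :
    ∃ N : ModuleCat.{u} R, IsGorensteinProjective R N ∧ ProjectiveLink R M N := by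
  obtain ⟨N, hN, ⟨e⟩⟩ := h.exists_chain
  exact ⟨N (0 + 1), isGorensteinProjective_of_chain N hN _, (hN 0).congr_left e⟩

theorem IsGorensteinProjective.exists_prev (h : IsGorensteinProjective R M) :
    ∃ N : ModuleCat.{u} R, IsGorensteinProjective R N ∧ ProjectiveLink R N M := by
  obtain ⟨N, hN, ⟨e⟩⟩ := h.exists_chain
  exact ⟨N (-1), isGorensteinProjective_of_chain N hN _, (hN (-1)).congr_right e.symm⟩

/-- A module lying between two Gorenstein projective modules in a chain of links is Gorenstein
projective. -/
theorem isGorensteinProjective_of_links (hB : IsGorensteinProjective R B)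
    (hMB : ProjectiveLink R M B) (hC : IsGorensteinProjective R C)
    (hCM : ProjectiveLink R C M) : IsGorensteinProjective R M := by
  refine isGorensteinProjective_of_class
    (fun A => IsGorensteinProjective R A ∨ Nonempty (A ≃ₗ[R] M)) ?_ ?_ (Or.inr ⟨.refl R M⟩)
  · rintro A (hA | ⟨⟨e⟩⟩)
    · obtain ⟨N, hN, hl⟩ := hA.exists_next
      exact ⟨N, .inl hN, hl⟩
    · exact ⟨ModuleCat.of R B, .inl hB, hMB.congr_left e⟩
  · rintro A (hA | ⟨⟨e⟩⟩)
    · obtain ⟨N, hN, hl⟩ := hA.exists_prev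
      exact ⟨N, .inl hN, hl⟩
    · exact ⟨ModuleCat.of R C, .inl hC, hCM.congr_right e.symm⟩

/-- Projective modules are Gorenstein projective. -/
theorem IsGorensteinProjective.of_projective [Module.Projective R M] :
    IsGorensteinProjective R M := by
  refine isGorensteinProjective_of_class (fun A => Module.Projective R A) ?_ ?_ ‹_›
  · intro A hA
    refine ⟨ModuleCat.of R PUnit, inferInstanceAs (Module.Projective R PUnit.{u + 1}), A, .id, 0, hA,
      injective_id, fun x => by simp, fun x => ⟨0, rfl⟩, fun Q _ _ _ h => ⟨h, fun _ => rfl⟩⟩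
  · intro A hA
    refine ⟨ModuleCat.of R PUnit, inferInstanceAs (Module.Projective R PUnit.{u + 1}), A, 0, .id, hA,
      fun _ _ _ => rfl, fun x => ?_, surjective_id, fun Q _ _ _ h => ⟨0, fun a => ?_⟩⟩
    · exact ⟨fun h => ⟨PUnit.unit, h.symm⟩, fun ⟨_, h⟩ => h.symm⟩
    · rw [show a = 0 from rfl]; simp

/-- This is `Ext¹(C, Q) = 0` for `C` Gorenstein projective and `Q` projective. -/
theorem IsGorensteinProjective.extendsToProjective (hC : IsGorensteinProjective R C)
    {i : A →ₗ[R] E} {p : E →ₗ[R] C} (hi : Injective i) (hip : Exact i p) (hp : Surjective p) :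
    i.ExtendsToProjective := by
  intro Q _ _ _ h
  obtain ⟨K, -, P, f, g, hP, hf, hfg, hg, hex⟩ := hC.exists_prev
  obtain ⟨t, ht⟩ := Module.projective_lifting_property p g hp
  replace ht : ∀ x, p (t x) = g x := LinearMap.congr_fun ht
  obtain ⟨u, hu⟩ := LinearMap.exists_comp_eq_of_forall_mem i hi (t ∘ₗ f) (fun c =>
    (hip _).1 (by simp [ht, (hfg _).2 ⟨c, rfl⟩]))
  obtain ⟨v, hv⟩ := hex Q (h ∘ₗ u)
  -- `A × P` surjects onto `E`, and the map `(h, v)` to `Q` vanishes on the kernel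
  obtain ⟨k, hk⟩ := LinearMap.exists_comp_eq_of_ker_le (i.coprod t) (fun e => by
    obtain ⟨x, hx⟩ := hg (p e)
    obtain ⟨a, ha⟩ := (hip (e - t x)).1 (by simp [ht, hx])
    exact ⟨(a, x), by simp [ha]⟩) (h.coprod v) (by
    rintro ⟨a, x⟩ hax
    replace hax : i a + t x = 0 := by simpa using hax
    obtain ⟨y, rfl⟩ := (hfg x).1 (by
      have := congrArg p hax
      simpa [ht, (hip _).2 ⟨a, rfl⟩] using this)
    have : a = -u y := hi (by rw [map_neg, hu]; exact eq_neg_of_add_eq_zero_left hax)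
    simp [this, hv])
  exact ⟨k, fun a => by simpa using hk (a, 0)⟩

/-- The horseshoe for the extension property: it passes from the two outer terms of a short exact
sequence to the middle term. -/
theorem LinearMap.ExtendsToProjective.horseshoe {PA PC : Type u} [AddCommGroup PA] [Module R PA]
    [AddCommGroup PC] [Module R PC] {fA : A →ₗ[R] PA} {fC : C →ₗ[R] PC}
    (hA : fA.ExtendsToProjective) (hC : fC.ExtendsToProjective)
    {i : A →ₗ[R] E} {p : E →ₗ[R] C} (hip : Exact i p) (hp : Surjective p)
    (j : E →ₗ[R] PA × PC) (hj1 : ∀ a, (j (i a)).1 = fA a) (hj2 : ∀ e, (j e).2 = fC (p e)) :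
    j.ExtendsToProjective := by
  intro Q _ _ _ h
  obtain ⟨v, hv⟩ := hA Q (h ∘ₗ i)
  obtain ⟨w, hw⟩ := LinearMap.exists_comp_eq_of_ker_le p hp (h - v ∘ₗ LinearMap.fst R _ _ ∘ₗ j)
    (fun e he => by
      obtain ⟨a, rfl⟩ := (hip e).1 he
      simp [hj1, hv])
  obtain ⟨w', hw'⟩ := hC Q w
  exact ⟨v.coprod w', fun e => by simp [hj2, hw', hw]⟩

/-- The class of Gorenstein projective modules is closed under extensions. -/
theorem IsGorensteinProjective.of_extension (hA : IsGorensteinProjective R A)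
    (hC : IsGorensteinProjective R C) (i : A →ₗ[R] E) (p : E →ₗ[R] C) (hi : Injective i)
    (hip : Exact i p) (hp : Surjective p) : IsGorensteinProjective R E := by
  refine isGorensteinProjective_of_class (fun E => ∃ (A C : ModuleCat.{u} R) (i : A →ₗ[R] E)
    (p : E →ₗ[R] C), IsGorensteinProjective R A ∧ IsGorensteinProjective R C ∧ Injective i ∧
      Exact i p ∧ Surjective p) ?_ ?_ ⟨.of R A, .of R C, i, p, hA, hC, hi, hip, hp⟩
  · rintro E ⟨A, C, i, p, hA, hC, hi, hip, hp⟩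
    obtain ⟨A₁, hA₁, PA, fA, gA, hPA, hfA, hfgA, hgA, hexA⟩ := hA.exists_next
    obtain ⟨C₁, hC₁, PC, fC, gC, hPC, hfC, hfgC, hgC, hexC⟩ := hC.exists_next
    obtain ⟨a, ha⟩ := hC.extendsToProjective hi hip hp PA fA
    have hpi : ∀ x, p (i x) = 0 := fun x => (hip _).2 ⟨x, rfl⟩
    -- the cokernel of `j : E → PA × PC` is an extension of `C₁` by `A₁`
    let j : E →ₗ[R] PA × PC := a.prod (fC ∘ₗ p)
    have hj : ∀ e, j e = (a e, fC (p e)) := fun e => rfl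
    have hgf : ∀ x, gC (fC x) = 0 := fun x => (hfgC _).2 ⟨x, rfl⟩
    have hj0 : ∀ e, (j e).2 = 0 → ∃ z, e = i z ∧ (j e).1 = fA z := fun e he => by
      obtain ⟨z, rfl⟩ := (hip e).1 (hfC (by simpa [hj] using he))
      exact ⟨z, rfl, ha z⟩
    let q := (LinearMap.range j).mkQ
    obtain ⟨α, hα⟩ := LinearMap.exists_comp_eq_of_ker_le gA hgA (q ∘ₗ LinearMap.inl R PA PC)
      (fun x hx => by
        obtain ⟨z, rfl⟩ := (hfgA x).1 hx
        refine (Submodule.Quotient.mk_eq_zero _).2 ⟨i z, ?_⟩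
        simp [hj, ha, hpi])
    let β := (LinearMap.range j).liftQ (gC ∘ₗ LinearMap.snd R PA PC) (by
      rintro _ ⟨e, rfl⟩
      simp [hj, hgf])
    have hβ : ∀ z, β (q z) = gC z.2 := fun z => rfl
    refine ⟨.of R ((PA × PC) ⧸ LinearMap.range j), ⟨A₁, C₁, α, β, hA₁, hC₁, ?_, ?_, ?_⟩,
      .of R (PA × PC), j, q, inferInstanceAs (Module.Projective R (PA × PC)), ?_, ?_,
      Submodule.mkQ_surjective _, hexA.horseshoe hexC hip hp j ha fun _ => rfl⟩
    · refine (injective_iff_map_eq_zero α).2 fun x hx => ?_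
      obtain ⟨x, rfl⟩ := hgA x
      rw [hα] at hx
      obtain ⟨e, he⟩ := (Submodule.Quotient.mk_eq_zero _).1 hx
      obtain ⟨z, rfl, hz⟩ := hj0 e (by rw [he]; rfl)
      exact (hfgA x).2 ⟨z, by rw [← hz, he]; rfl⟩
    · intro z
      obtain ⟨⟨x, y⟩, rfl⟩ := Submodule.mkQ_surjective _ z
      constructor
      · intro hz
        obtain ⟨c, hc⟩ := (hfgC y).1 hz
        obtain ⟨e, rfl⟩ := hp c
        refine ⟨gA (x - a e), ?_⟩
        rw [hα]
        refine (Submodule.Quotient.eq _).2 ⟨-e, ?_⟩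
        simp [hj, hc]
      · rintro ⟨w, hw⟩
        obtain ⟨w, rfl⟩ := hgA w
        rw [← hw, hα]
        exact map_zero gC
    · intro c
      obtain ⟨y, rfl⟩ := hgC c
      exact ⟨q (0, y), rfl⟩
    · refine (injective_iff_map_eq_zero j).2 fun e he => ?_
      obtain ⟨z, rfl, hz⟩ := hj0 e (by rw [he]; rfl)
      rw [hfA (a₁ := z) (a₂ := 0) (by rw [← hz, he, map_zero]; rfl), map_zero]
    · exact LinearMap.exact_map_mkQ_range j
  · rintro E ⟨A, C, i, p, hA, hC, hi, hip, hp⟩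
    obtain ⟨A₀, hA₀, PA, fA, gA, hPA, hfA, hfgA, hgA, hexA⟩ := hA.exists_prev
    obtain ⟨C₀, hC₀, PC, fC, gC, hPC, hfC, hfgC, hgC, hexC⟩ := hC.exists_prev
    have hpi : ∀ x, p (i x) = 0 := fun x => (hip _).2 ⟨x, rfl⟩
    obtain ⟨t, ht⟩ := Module.projective_lifting_property p gC hp
    replace ht : ∀ x, p (t x) = gC x := LinearMap.congr_fun ht
    -- the kernel of `φ : PA × PC → E` is an extension of `C₀` by `A₀`
    let φ : PA × PC →ₗ[R] E := (i ∘ₗ gA).coprod t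
    have hφ : ∀ x y, φ (x, y) = i (gA x) + t y := fun x y => rfl
    let j := (LinearMap.ker φ).subtype
    let α : A₀ →ₗ[R] LinearMap.ker φ := (LinearMap.inl R PA PC ∘ₗ fA).codRestrict _ fun x => by
      simp [hφ, (hfgA _).2 ⟨x, rfl⟩]
    obtain ⟨β, hβ⟩ := LinearMap.exists_comp_eq_of_forall_mem fC hfC (LinearMap.snd R PA PC ∘ₗ j)
      (by
        rintro ⟨⟨x, y⟩, hxy⟩
        refine (hfgC _).1 ?_
        have := congrArg p hxy
        change gC y = 0
        simpa [hφ, ht, hpi] using this)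
    have hαβ : Exact α β := by
      rintro ⟨⟨x, y⟩, hxy⟩
      constructor
      · intro h0
        have hy : y = 0 := by
          have := hβ ⟨⟨x, y⟩, hxy⟩
          rw [h0, map_zero] at this
          exact this.symm
        subst hy
        obtain ⟨a, rfl⟩ := (hfgA x).1 (hi (by simpa [hφ] using hxy))
        exact ⟨a, rfl⟩
      · rintro ⟨a, ha⟩
        rw [← ha]
        apply hfC
        rw [hβ, map_zero]
        rfl
    have hβs : Surjective β := fun c => by
      obtain ⟨a, ha⟩ := (hip (t (fC c))).1 (by rw [ht]; exact (hfgC _).2 ⟨c, rfl⟩)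
      obtain ⟨x, rfl⟩ := hgA a
      refine ⟨⟨(-x, fC c), ?_⟩, hfC ?_⟩
      · simp [hφ, ha]
      · rw [hβ]; rfl
    refine ⟨.of R (LinearMap.ker φ), ⟨A₀, C₀, α, β, hA₀, hC₀, ?_, hαβ, hβs⟩,
      .of R (PA × PC), j, φ, inferInstanceAs (Module.Projective R (PA × PC)),
      Subtype.val_injective, LinearMap.exact_subtype_ker_map φ, ?_,
      hexA.horseshoe hexC hαβ hβs j (fun _ => rfl) fun e => (hβ e).symm⟩
    · exact fun x y hxy => hfA (congrArg (fun z => z.1.1) hxy)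
    · intro e
      obtain ⟨y, hy⟩ := hgC (p e)
      obtain ⟨a, ha⟩ := (hip (e - t y)).1 (by simp [ht, hy])
      obtain ⟨x, rfl⟩ := hgA a
      exact ⟨(x, y), by simp [hφ, ha]⟩

theorem IsGorensteinProjective.prod (hA : IsGorensteinProjective R A)
    (hC : IsGorensteinProjective R C) : IsGorensteinProjective R (A × C) :=
  hA.of_extension hC (LinearMap.inl R A C) (LinearMap.snd R A C) LinearMap.inl_injective
    .inl_snd LinearMap.snd_surjective

/-- A projective direct summand may be cancelled from a Gorenstein projective module. -/
theorem IsGorensteinProjective.of_prod_projective [Module.Projective R C]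
    (h : IsGorensteinProjective R (K × C)) : IsGorensteinProjective R K := by
  obtain ⟨N, hN, P, f, g, hP, hf, hfg, hg, hex⟩ := h.exists_next
  obtain ⟨N', hN', P', f', g', hP', hf', hfg', hg', hex'⟩ := h.exists_prev
  have hgf : ∀ x, g (f x) = 0 := fun x => (hfg _).2 ⟨x, rfl⟩
  -- the cokernel of `K → K × C → P` is an extension of `N` by `C`
  let j := f ∘ₗ LinearMap.inl R K C
  let E := P ⧸ LinearMap.range j
  let α : C →ₗ[R] E := (LinearMap.range j).mkQ ∘ₗ f ∘ₗ LinearMap.inr R K C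
  let β : E →ₗ[R] N := (LinearMap.range j).liftQ g (by
    rintro _ ⟨k, rfl⟩
    simp [j, hgf])
  have hE : IsGorensteinProjective R E := by
    refine (of_projective (R := R) (M := C)).of_extension hN α β ?_ ?_ ?_
    · refine (injective_iff_map_eq_zero α).2 fun x hx => ?_
      obtain ⟨k, hk⟩ := (Submodule.Quotient.mk_eq_zero _).1 hx
      exact (congrArg Prod.snd (hf hk)).symm
    · intro z
      obtain ⟨x, rfl⟩ := Submodule.mkQ_surjective _ z
      constructor
      · intro hz
        obtain ⟨⟨k, c⟩, rfl⟩ := (hfg x).1 hz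
        refine ⟨c, (Submodule.Quotient.eq _).2 ⟨-k, ?_⟩⟩
        simp [j, ← map_sub]
      · rintro ⟨c, hc⟩
        rw [← hc]
        exact hgf _
    · intro y
      obtain ⟨x, rfl⟩ := hg y
      exact ⟨(LinearMap.range j).mkQ x, rfl⟩
  refine isGorensteinProjective_of_links hE ⟨P, j, (LinearMap.range j).mkQ, hP,
    hf.comp LinearMap.inl_injective, LinearMap.exact_map_mkQ_range j,
    Submodule.mkQ_surjective _, ?_⟩ hN' ?_
  · intro Q _ _ _ h
    obtain ⟨k, hk⟩ := hex Q (h ∘ₗ LinearMap.fst R K C)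
    exact ⟨k, fun a => by simp [j, hk]⟩
  · -- the preimage of `K` in `P'` is the kernel of a split surjection onto `C`
    let s := LinearMap.snd R K C ∘ₗ g'
    have hs : Surjective s := (LinearMap.snd_surjective (R := R)).comp hg'
    obtain ⟨t, ht⟩ := Module.projective_lifting_property s .id hs
    replace ht : ∀ x, s (t x) = x := LinearMap.congr_fun ht
    have hL : Module.Projective R (LinearMap.ker s) :=
      Module.Projective.of_split (LinearMap.ker s).subtype
        ((LinearMap.id - t ∘ₗ s).codRestrict _ fun x => by simp [ht])
        (LinearMap.ext fun x => Subtype.ext (by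
          have : s x = 0 := x.2
          simp [this]))
    have hgf' : ∀ x, g' (f' x) = 0 := fun x => (hfg' _).2 ⟨x, rfl⟩
    refine ⟨.of R (LinearMap.ker s), f'.codRestrict _ fun x => by simp [s, hgf'],
      LinearMap.fst R K C ∘ₗ g' ∘ₗ (LinearMap.ker s).subtype, hL,
      fun x y hxy => hf' (congrArg Subtype.val hxy), ?_, ?_, ?_⟩
    · rintro ⟨x, hx⟩
      constructor
      · intro h1
        obtain ⟨y, rfl⟩ := (hfg' x).1 (Prod.ext h1 hx)
        exact ⟨y, rfl⟩
      · rintro ⟨y, hy⟩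
        obtain rfl : f' y = x := congrArg Subtype.val hy
        simp [hgf']
    · intro k
      obtain ⟨x, hx⟩ := hg' (k, 0)
      exact ⟨⟨x, by simp [s, hx]⟩, by simp [hx]⟩
    · intro Q _ _ _ h
      obtain ⟨k, hk⟩ := hex' Q h
      exact ⟨k ∘ₗ (LinearMap.ker s).subtype, hk⟩

/-- The kernel of a surjection between Gorenstein projective modules is Gorenstein projective: for
a projective presentation `0 → G' → P → G → 0` of the target, `K × P` is an extension of `H` by
`G'`. -/
theorem IsGorensteinProjective.of_kernel (hH : IsGorensteinProjective R H)
    (hG : IsGorensteinProjective R G) (i : K →ₗ[R] H) (p : H →ₗ[R] G) (hi : Injective i)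
    (hip : Exact i p) (hp : Surjective p) : IsGorensteinProjective R K := by
  obtain ⟨G', hG', P, f, g, hP, hf, hfg, hg, -⟩ := hG.exists_prev
  have hpi : ∀ x, p (i x) = 0 := fun x => (hip _).2 ⟨x, rfl⟩
  have hgf : ∀ x, g (f x) = 0 := fun x => (hfg _).2 ⟨x, rfl⟩
  obtain ⟨t, ht⟩ := Module.projective_lifting_property p g hp
  replace ht : ∀ x, p (t x) = g x := LinearMap.congr_fun ht
  obtain ⟨u, hu⟩ := LinearMap.exists_comp_eq_of_forall_mem i hi (t ∘ₗ f) (fun c =>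
    (hip _).1 (by simp [ht, hgf]))
  refine of_prod_projective (C := P)
    (of_extension hG' hH ((-u).prod f) (i.coprod t) ?_ ?_ ?_)
  · exact fun x y hxy => hf (congrArg Prod.snd hxy)
  · rintro ⟨k, x⟩
    constructor
    · intro h
      replace h : i k + t x = 0 := by simpa using h
      obtain ⟨y, rfl⟩ := (hfg x).1 (by
        have := congrArg p h
        simpa [ht, hpi] using this)
      refine ⟨y, Prod.ext (hi ?_) rfl⟩
      change i (-u y) = i k
      rw [map_neg, hu]
      exact (eq_neg_of_add_eq_zero_left h).symm
    · rintro ⟨y, hy⟩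
      rw [← hy]
      simp [hu]
  · intro x
    obtain ⟨y, hy⟩ := hg (p x)
    obtain ⟨a, ha⟩ := (hip (x - t y)).1 (by simp [ht, hy])
    exact ⟨(a, y), by simp [ha]⟩

/-- The cokernel of an embedding of a Gorenstein projective module `M` into a projective module `P`
is Gorenstein projective as soon as maps from `M` to projectives extend to `P`: for another such
embedding `M → P₀` with Gorenstein projective cokernel `N`, the module `C × P₀` is an extension of
`N` by `P`. -/
theorem IsGorensteinProjective.of_cokernel {P : Type u} [AddCommGroup P] [Module R P]
    [Module.Projective R P] (hM : IsGorensteinProjective R M) (i : M →ₗ[R] P) (c : P →ₗ[R] C)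
    (hic : Exact i c) (hc : Surjective c) (hex : i.ExtendsToProjective) :
    IsGorensteinProjective R C := by
  obtain ⟨N, hN, P₀, f, g, hP₀, hf, hfg, hg, -⟩ := hM.exists_next
  have hgf : ∀ x, g (f x) = 0 := fun x => (hfg _).2 ⟨x, rfl⟩
  have hci : ∀ x, c (i x) = 0 := fun x => (hic _).2 ⟨x, rfl⟩
  obtain ⟨u, hu⟩ := hex P₀ f
  obtain ⟨w, hw⟩ := LinearMap.exists_comp_eq_of_ker_le c hc (g ∘ₗ u) (fun x hx => by
    obtain ⟨m, rfl⟩ := (hic x).1 hx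
    simp [hu, hgf])
  refine of_prod_projective (C := P₀) ((of_projective (R := R) (M := P)).of_extension hN
    (c.prod u) ((-w).coprod g) ?_ ?_ ?_)
  · refine (injective_iff_map_eq_zero _).2 fun x hx => ?_
    obtain ⟨m, rfl⟩ := (hic x).1 (congrArg Prod.fst hx)
    have h2 : u (i m) = 0 := congrArg Prod.snd hx
    rw [hu] at h2
    rw [hf (h2.trans (map_zero f).symm), map_zero]
  · rintro ⟨y, x⟩
    obtain ⟨z, rfl⟩ := hc y
    constructor
    · intro h
      obtain ⟨m, hm⟩ := (hfg (x - u z)).1 (by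
        have : -g (u z) + g x = 0 := by simpa [hw] using h
        rw [map_sub, sub_eq_neg_add, this])
      exact ⟨z + i m, by simp [hci, hu, hm]⟩
    · rintro ⟨v, hv⟩
      rw [← hv]
      simp [hw]
  · intro n
    obtain ⟨x, rfl⟩ := hg n
    exact ⟨(0, x), by simp⟩

end Basic

/-! ### Gorenstein projective resolutions -/

section Resolution

variable {R : Type u} [Ring R]

variable {C K G M N X : Type u} [AddCommGroup C] [Module R C] [AddCommGroup K] [Module R K]
  [AddCommGroup G] [Module R G] [AddCommGroup M] [Module R M]
  [AddCommGroup N] [Module R N] [AddCommGroup X] [Module R X]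

namespace HasGorensteinProjectiveResolution

theorem zero_iff : HasGorensteinProjectiveResolution R M 0 ↔ IsGorensteinProjective R M := by
  constructor
  · rintro ⟨G, d, ε, hG, hs, hd, hdε, hε⟩
    have := hs 1 Nat.one_pos
    refine (hG 0 le_rfl).congr (LinearEquiv.ofBijective ε
      ⟨(injective_iff_map_eq_zero ε).2 fun x hx => ?_, hε⟩).symm
    obtain ⟨y, rfl⟩ := (hdε x).1 hx
    rw [Subsingleton.elim y 0, map_zero]
  · intro h
    refine ⟨fun i => match i with
      | 0 => .of R M
      | _ + 1 => .of R PUnit.{u + 1}, fun i => 0, .id, ?_, ?_, ?_, ?_, surjective_id⟩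
    · intro i hi
      obtain rfl := Nat.le_zero.1 hi
      exact h
    · intro i hi
      obtain ⟨i, rfl⟩ := Nat.exists_eq_succ_of_ne_zero hi.ne'
      exact inferInstanceAs (Subsingleton PUnit)
    · intro i x
      exact ⟨fun _ => ⟨0, rfl⟩, fun _ => rfl⟩
    · intro x
      exact ⟨fun h => ⟨0, h.symm⟩, fun ⟨_, h⟩ => h.symm⟩

/-- A resolution of `M` is put together from a short exact sequence `0 → K → G → M → 0` and a
resolution of `K`. -/
theorem cons {n : ℕ} (h : HasGorensteinProjectiveResolution R K n)
    (hG : IsGorensteinProjective R G) (i : K →ₗ[R] G) (p : G →ₗ[R] M) (hi : Injective i)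
    (hip : Exact i p) (hp : Surjective p) :
    HasGorensteinProjectiveResolution R M (n + 1) := by
  obtain ⟨F, d, ε, hF, hs, hd, hdε, hε⟩ := h
  let F' : ℕ → ModuleCat.{u} R := fun i => match i with
    | 0 => .of R G
    | i + 1 => F i
  let d' : ∀ i, F' (i + 1) →ₗ[R] F' i := fun j => match j with
    | 0 => i ∘ₗ ε
    | j + 1 => d j
  refine ⟨F', d', p, ?_, ?_, ?_, fun x => ?_, hp⟩
  · rintro (_ | j) hj
    · exact hG
    · exact hF j (by lia)
  · rintro (_ | j) hj
    · lia
    · exact hs j (by lia)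
  · rintro (_ | j)
    · exact hi.comp_exact_iff_exact.2 hdε
    · exact hd j
  · exact (hip x).trans ⟨fun ⟨y, hy⟩ => (hε y).imp fun z hz => (congrArg i hz).trans hy,
      fun ⟨z, hz⟩ => ⟨ε z, hz⟩⟩

theorem uncons {n : ℕ} (h : HasGorensteinProjectiveResolution R M (n + 1)) :
    ∃ (G : ModuleCat.{u} R) (p : G →ₗ[R] M), IsGorensteinProjective R G ∧ Surjective p ∧
      HasGorensteinProjectiveResolution R (LinearMap.ker p) n := by
  obtain ⟨F, d, ε, hF, hs, hd, hdε, hε⟩ := h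
  refine ⟨F 0, ε, hF 0 (Nat.zero_le _), hε, fun i => F (i + 1), fun i => d (i + 1),
    (d 0).codRestrict _ fun x => (hdε _).2 ⟨x, rfl⟩, fun i hi => hF _ (by lia),
    fun i hi => hs _ (by lia), fun i => hd (i + 1), fun x => ?_, fun ⟨y, hy⟩ => ?_⟩
  · exact Subtype.ext_iff.trans (hd 0 x)
  · obtain ⟨x, hx⟩ := (hdε y).1 hy
    exact ⟨x, Subtype.ext hx⟩

theorem prod_projective {n : ℕ} (h : HasGorensteinProjectiveResolution R N n)
    [Module.Projective R C] : HasGorensteinProjectiveResolution R (N × C) n := by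
  cases n with
  | zero => exact zero_iff.2 ((zero_iff.1 h).prod .of_projective)
  | succ n =>
    obtain ⟨G, p, hG, hp, hK⟩ := h.uncons
    refine hK.cons (hG.prod (.of_projective (M := C)))
      (LinearMap.inl R G C ∘ₗ (LinearMap.ker p).subtype) (p.prodMap .id)
      (LinearMap.inl_injective.comp Subtype.val_injective) ?_ (hp.prodMap surjective_id)
    rintro ⟨x, c⟩
    constructor
    · intro h
      obtain rfl : c = 0 := congrArg Prod.snd h
      exact ⟨⟨x, congrArg Prod.fst h⟩, rfl⟩
    · rintro ⟨⟨y, hy⟩, hyx⟩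
      rw [← hyx]
      exact Prod.ext hy rfl

/-- The kernel of a surjection onto a Gorenstein projective module has a resolution of the same
length: replace the first term `H → X` of the resolution by the kernel of `H → X → G`. -/
theorem of_kernel {n : ℕ} (hX : HasGorensteinProjectiveResolution R X n)
    (hG : IsGorensteinProjective R G) (i : K →ₗ[R] X) (p : X →ₗ[R] G) (hi : Injective i)
    (hip : Exact i p) (hp : Surjective p) : HasGorensteinProjectiveResolution R K n := by
  cases n with
  | zero => exact zero_iff.2 ((zero_iff.1 hX).of_kernel hG i p hi hip hp)
  | succ n =>
    obtain ⟨H, q, hH, hq, hX₁⟩ := hX.uncons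
    have hK₀ : IsGorensteinProjective R (LinearMap.ker (p ∘ₗ q)) :=
      hH.of_kernel hG (LinearMap.ker (p ∘ₗ q)).subtype (p ∘ₗ q) Subtype.val_injective
        (LinearMap.exact_subtype_ker_map _) (hp.comp hq)
    obtain ⟨r, hr⟩ := LinearMap.exists_comp_eq_of_forall_mem i hi
      (q ∘ₗ (LinearMap.ker (p ∘ₗ q)).subtype) fun x => (hip _).1 x.2
    refine hX₁.cons hK₀ (Submodule.inclusion (LinearMap.ker_le_ker_comp q p)) r
      (Submodule.inclusion_injective _) (fun x => ?_) fun k => ?_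
    · constructor
      · intro hx
        exact ⟨⟨x.1, by have := hr x; rw [hx, map_zero] at this; exact this.symm⟩, rfl⟩
      · rintro ⟨y, rfl⟩
        exact hi ((hr _).trans (y.2.trans (map_zero i).symm))
    · obtain ⟨x, hx⟩ := hq (i k)
      exact ⟨⟨x, by simpa [hx] using (hip _).2 ⟨k, rfl⟩⟩, hi ((hr _).trans hx)⟩

/-- A projective presentation shortens Gorenstein projective resolutions by one: if
`0 → N → G → M → 0` is the start of the given resolution and `0 → K → P → M → 0` is exact with `P`
projective, then `K` is also the kernel of a surjection `N × P → G`. -/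
theorem kernel_projective {n : ℕ} {P : Type u} [AddCommGroup P] [Module R P]
    [Module.Projective R P] (hM : HasGorensteinProjectiveResolution R M (n + 1))
    (i : K →ₗ[R] P) (π : P →ₗ[R] M) (hi : Injective i) (hiπ : Exact i π) (hπ : Surjective π) :
    HasGorensteinProjectiveResolution R K n := by
  obtain ⟨G, p, hG, hp, hN⟩ := hM.uncons
  obtain ⟨t, ht⟩ := Module.projective_lifting_property p π hp
  replace ht : ∀ x, p (t x) = π x := LinearMap.congr_fun ht
  have hπi : ∀ x, π (i x) = 0 := fun x => (hiπ _).2 ⟨x, rfl⟩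
  let s : K →ₗ[R] LinearMap.ker p := (t ∘ₗ i).codRestrict _ fun x => by simp [ht, hπi]
  refine (hN.prod_projective (C := P)).of_kernel hG ((-s).prod i)
    ((LinearMap.ker p).subtype.coprod t) (fun x y hxy => hi (congrArg Prod.snd hxy)) ?_ ?_
  · rintro ⟨⟨y, hy⟩, x⟩
    constructor
    · intro h
      replace h : y + t x = 0 := h
      obtain ⟨k, rfl⟩ := (hiπ x).1 (by
        have := congrArg p h
        simpa [ht, LinearMap.mem_ker.1 hy] using this)
      exact ⟨k, Prod.ext (Subtype.ext (eq_neg_of_add_eq_zero_left h).symm) rfl⟩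
    · rintro ⟨k, hk⟩
      rw [← hk]
      simp [s]
  · intro y
    obtain ⟨x, hx⟩ := hπ (p y)
    exact ⟨(⟨y - t x, by simp [ht, hx]⟩, x), by simp⟩

end HasGorensteinProjectiveResolution

end Resolution

/-! ### Frobenius systems, traces and coinduced modules -/

section Frobenius

/-- A Frobenius form `ε : S → R` together with dual bases `x`, `y`. The action of `R` on `S` is
recorded by a module structure compatible with the multiplication of `S`, so that the ring
homomorphism `R → S` is `r ↦ r • 1`. -/
structure FrobeniusSystem (R S : Type u) [Ring R] [Ring S] [Module R S] [IsScalarTower R S S] where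
  n : ℕ
  ε : S →ₗ[R] R
  x : Fin n → S
  y : Fin n → S
  ε_mul_smul_one : ∀ s r, ε (s * r • 1) = ε s * r
  sum_smul_x : ∀ s, ∑ i, ε (s * y i) • x i = s
  sum_y_mul : ∀ s, ∑ i, y i * ε (x i * s) • 1 = s

/-- The form is `ε = e 1`, where `e : S ≅ Hom_R(S, R)` is the bimodule isomorphism; then
`e s t = ε (t * s)`. -/
theorem exists_frobeniusSystem {R S : Type u} [Ring R] [Ring S] (l : R →+* S)
    (hl : IsFrobeniusExtension l) :
    let _ : Module R S := Module.compHom S l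
    ∃ _ : IsScalarTower R S S, Nonempty (FrobeniusSystem R S) := by
  let _ : Module R S := Module.compHom S l
  obtain ⟨hfin, hproj, e, he1, he2⟩ := hl
  have hsmul : ∀ (r : R) (s : S), r • s = l r * s := fun _ _ => rfl
  have hst : IsScalarTower R S S := ⟨fun r s t => mul_assoc (l r) s t⟩
  refine ⟨hst, ?_⟩
  have he : ∀ s t, e s t = e 1 (t * s) := fun s t => by rw [← he1, mul_one]
  have hε : ∀ s r, e 1 (s * l r) = e 1 s * r := fun s r => by rw [← he, ← he2, one_mul]
  -- a dual basis of the finitely generated projective module `S`, whose coordinate functions are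
  -- of the form `e 1 (_ * y i)`
  obtain ⟨n, p, q, -, -, hpq⟩ := Module.Finite.exists_comp_eq_id_of_projective R S
  choose y hy using fun i => e.surjective (LinearMap.proj i ∘ₗ q)
  have hqy : ∀ i s, q s i = e 1 (s * y i) := fun i s => by rw [← he, hy]; rfl
  have h1 : ∀ s, ∑ i, e 1 (s * y i) • p (Pi.single i 1) = s := fun s => by
    have h := LinearMap.congr_fun hpq s
    rw [LinearMap.comp_apply, ← Finset.univ_sum_single (q s), map_sum] at h
    simpa [← hqy, ← map_smul, ← Pi.single_smul] using h
  refine ⟨⟨n, e 1, fun i => p (Pi.single i 1), y, fun s r => ?_, h1, fun s => ?_⟩⟩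
  · rw [hsmul, mul_one, hε]
  · -- the form is nondegenerate, so it is enough to compare `ε (t * _)` on both sides
    refine e.injective (LinearMap.ext fun t => ?_)
    rw [he, he s, Finset.mul_sum, map_sum]
    conv_rhs => rw [← h1 t, Finset.sum_mul, map_sum]
    refine Finset.sum_congr rfl fun i _ => ?_
    rw [hsmul, mul_one, ← mul_assoc, hε, hsmul, mul_assoc, ← hsmul, map_smul, smul_eq_mul]

variable {R S : Type u} [Ring R] [Ring S] [Module R S]

section Restriction

variable [IsScalarTower R S S]

variable (R S) in
/-- Restriction of scalars along `r ↦ r • 1`. -/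
theorem exists_restrict (M : Type u) [AddCommGroup M] [Module S M] :
    ∃ _ : Module R M, IsScalarTower R S M := by
  let _ : Module R M := Module.compHom M (RingHom.smulOneHom : R →+* S)
  refine ⟨‹_›, ⟨fun r s m => ?_⟩⟩
  change (r • s) • m = (r • (1 : S)) • s • m
  rw [smul_smul, smul_one_mul]

theorem Module.Projective.restrict_tower {M : Type u} [AddCommGroup M] [Module R M] [Module S M]
    [IsScalarTower R S M] [Module.Projective R S] [Module.Projective S M] :
    Module.Projective R M := by
  classical
  have : Module.Projective R (M →₀ S) := .of_equiv' (finsuppLequivDFinsupp R).symm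
  obtain ⟨s, hs⟩ := Module.projective_def'.1 ‹Module.Projective S M›
  exact Module.Projective.of_split (M := M →₀ S) (s.restrictScalars R)
    ((Finsupp.linearCombination S id).restrictScalars R)
    (LinearMap.ext fun x => LinearMap.congr_fun hs x)

end Restriction

section Coinduced

variable (R S) in
/-- The coinduced `S`-module `Hom_R(S, Q)` of an `R`-module `Q`, with `S` acting by
`(s • f) x = f (x * s)`. -/
def CoinducedModule (Q : Type u) [AddCommGroup Q] [Module R Q] : Type u := S →ₗ[R] Q

namespace CoinducedModule

variable (Q : Type u) [AddCommGroup Q] [Module R Q]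

instance : AddCommGroup (CoinducedModule R S Q) := inferInstanceAs (AddCommGroup (S →ₗ[R] Q))

instance : FunLike (CoinducedModule R S Q) S Q := inferInstanceAs (FunLike (S →ₗ[R] Q) S Q)

instance : LinearMapClass (CoinducedModule R S Q) R S Q :=
  inferInstanceAs (LinearMapClass (S →ₗ[R] Q) R S Q)

variable {Q} in
@[ext] theorem ext {f g : CoinducedModule R S Q} (h : ∀ x, f x = g x) : f = g :=
  LinearMap.ext h

@[simp] theorem add_apply (f g : CoinducedModule R S Q) (x : S) : (f + g) x = f x + g x := rfl

@[simp] theorem zero_apply (x : S) : (0 : CoinducedModule R S Q) x = 0 := rfl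

@[simp] theorem sum_apply {ι : Type*} (t : Finset ι) (f : ι → CoinducedModule R S Q) (x : S) :
    (∑ i ∈ t, f i) x = ∑ i ∈ t, f i x :=
  map_sum (M := CoinducedModule R S Q)
    { toFun := fun g => g x, map_zero' := rfl, map_add' := fun _ _ => rfl : _ →+ Q } f t

variable [IsScalarTower R S S]

instance : SMul S (CoinducedModule R S Q) :=
  ⟨fun s f => ((f : S →ₗ[R] Q) ∘ₗ
    { toFun := fun x => x * s
      map_add' := fun _ _ => add_mul _ _ _
      map_smul' := fun _ _ => smul_mul_assoc _ _ _ } : S →ₗ[R] Q)⟩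

@[simp] theorem smul_apply (s : S) (f : CoinducedModule R S Q) (x : S) :
    (s • f) x = f (x * s) := rfl

instance : Module S (CoinducedModule R S Q) where
  one_smul f := by ext; simp
  mul_smul s t f := by ext; simp [mul_assoc]
  smul_zero s := by ext; simp
  smul_add s f g := by ext; simp
  add_smul s t f := by ext; simp [mul_add]
  zero_smul f := by ext; simp

variable {Q} {A : Type u} [AddCommGroup A] [Module R A] [Module S A] [IsScalarTower R S A]

/-- The `S`-linear map `A → Hom_R(S, Q)` adjoint to an `R`-linear map `A → Q`. -/
def adjoint (h : A →ₗ[R] Q) : A →ₗ[S] CoinducedModule R S Q where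
  toFun a := (h ∘ₗ (LinearMap.toSpanSingleton S A a).restrictScalars R : S →ₗ[R] Q)
  map_add' a b := LinearMap.ext fun x => by
    change h (x • (a + b)) = h (x • a) + h (x • b)
    rw [smul_add, map_add]
  map_smul' s a := LinearMap.ext fun x => by
    change h (x • s • a) = h ((x * s) • a)
    rw [mul_smul]

@[simp] theorem adjoint_apply (h : A →ₗ[R] Q) (a : A) (x : S) : adjoint h a x = h (x • a) := rfl

variable (Q) in
/-- Evaluation at `1`, the counit of the coinduction adjunction. -/
def eval [Module R (CoinducedModule R S Q)] [IsScalarTower R S (CoinducedModule R S Q)] :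
    CoinducedModule R S Q →ₗ[R] Q where
  toFun f := f 1
  map_add' _ _ := rfl
  map_smul' r f := by
    rw [← smul_one_smul S r f, smul_apply, one_mul, map_smul]
    rfl

end CoinducedModule

end Coinduced

namespace FrobeniusSystem

variable [IsScalarTower R S S] (F : FrobeniusSystem R S) {A B M : Type u}
  [AddCommGroup A] [Module R A] [Module S A] [IsScalarTower R S A]
  [AddCommGroup B] [Module R B] [Module S B] [IsScalarTower R S B]
  [AddCommGroup M] [Module R M] [Module S M] [IsScalarTower R S M]

/-- The Casimir property of `∑ y i ⊗ x i`. -/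
theorem casimir {Q : Type u} [AddCommGroup Q] [Module R Q] (k : Q →ₗ[R] B) (φ : S →ₗ[R] Q)
    (s : S) : ∑ i, F.y i • k (φ (F.x i * s)) = s • ∑ i, F.y i • k (φ (F.x i)) := by
  calc ∑ i, F.y i • k (φ (F.x i * s))
      = ∑ i, ∑ j, (F.y i * F.ε (F.x i * s * F.y j) • 1) • k (φ (F.x j)) := by
        refine Finset.sum_congr rfl fun i _ => ?_
        conv_lhs => rw [← F.sum_smul_x (F.x i * s)]
        simp_rw [map_sum, map_smul, Finset.smul_sum, mul_smul, smul_one_smul]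
    _ = s • ∑ i, F.y i • k (φ (F.x i)) := by
        rw [Finset.sum_comm, Finset.smul_sum]
        refine Finset.sum_congr rfl fun j _ => ?_
        simp_rw [← Finset.sum_smul, mul_assoc (F.x _) s, F.sum_y_mul, mul_smul]

/-- The trace `a ↦ ∑ y i • k (x i • a)` of an `R`-linear map is `S`-linear. -/
def trace (k : A →ₗ[R] B) : A →ₗ[S] B where
  toFun a := ∑ i, F.y i • k (F.x i • a)
  map_add' a b := by simp [smul_add, Finset.sum_add_distrib]
  map_smul' s a := by
    have := F.casimir k ((LinearMap.toSpanSingleton S A a).restrictScalars R) s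
    simpa [mul_smul] using this

theorem trace_apply (k : A →ₗ[R] B) (a : A) : F.trace k a = ∑ i, F.y i • k (F.x i • a) := rfl

/-- On a projective `S`-module the identity is the trace of an `R`-linear endomorphism: on a free
module, apply `ε` to each coordinate. -/
theorem exists_trace_eq_id (F : FrobeniusSystem R S) [Module.Projective S M] :
    ∃ θ : M →ₗ[R] M, ∀ m, F.trace θ m = m := by
  obtain ⟨s, hs⟩ := Module.projective_def'.1 ‹Module.Projective S M›
  let ε' : S →ₗ[R] S := LinearMap.toSpanSingleton R S 1 ∘ₗ F.ε
  refine ⟨(Finsupp.linearCombination S id).restrictScalars R ∘ₗ Finsupp.mapRange.linearMap ε' ∘ₗ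
    s.restrictScalars R, fun m => ?_⟩
  -- coordinatewise this is the dual basis identity in `S`
  have key : ∑ i, F.y i • Finsupp.mapRange.linearMap ε' (F.x i • s m) = s m := by
    ext a
    simp [ε', Finsupp.finsetSum_apply, F.sum_y_mul]
  have := congrArg (Finsupp.linearCombination S id) key
  rw [map_sum] at this
  simpa [trace_apply] using this.trans (LinearMap.congr_fun hs m)

/-- An `S`-linear map along which maps to projective `R`-modules extend has the same property over
`S`. -/
theorem extendsToProjective (F : FrobeniusSystem R S) [Module.Projective R S] {f : A →ₗ[S] B}
    (hf : (f.restrictScalars R).ExtendsToProjective) : f.ExtendsToProjective := by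
  intro Q _ _ _ h
  obtain ⟨_, _⟩ := exists_restrict R S Q
  have : Module.Projective R Q := Module.Projective.restrict_tower (S := S)
  obtain ⟨θ, hθ⟩ := F.exists_trace_eq_id (M := Q)
  obtain ⟨k, hk⟩ := hf Q (θ ∘ₗ h.restrictScalars R)
  refine ⟨F.trace k, fun a => ?_⟩
  rw [← hθ (h a)]
  simp_rw [trace_apply, ← map_smul]
  exact Finset.sum_congr rfl fun i _ => congrArg _ (hk _)

/-- Coinduction along a Frobenius extension preserves projectivity, because it is also the
induction functor: `S`-linear maps out of `Hom_R(S, Q)` correspond to `R`-linear maps out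
of `Q` via the unit `q ↦ ε(_) • q`. -/
theorem projective_coinduced (F : FrobeniusSystem R S) (Q : Type u) [AddCommGroup Q] [Module R Q]
    [Module.Projective R Q] : Module.Projective S (CoinducedModule R S Q) := by
  obtain ⟨_, _⟩ := exists_restrict R S (CoinducedModule R S Q)
  let g := Finsupp.linearCombination S (id : CoinducedModule R S Q → CoinducedModule R S Q)
  have hg : Surjective g := Finsupp.linearCombination_id_surjective S _
  let u : Q → CoinducedModule R S Q := fun q => LinearMap.toSpanSingleton R Q q ∘ₗ F.ε
  have hu : ∀ q x, u q x = F.ε x • q := fun q x => rfl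
  let η : Q →ₗ[R] CoinducedModule R S Q :=
    { toFun := u
      map_add' := fun a b => CoinducedModule.ext fun x => smul_add (F.ε x) a b
      map_smul' := fun r a => by
        rw [RingHom.id_apply, ← smul_one_smul S r (u a)]
        ext x
        rw [CoinducedModule.smul_apply, hu, hu, F.ε_mul_smul_one, mul_smul] }
  have hη : ∀ q x, η q x = F.ε x • q := hu
  obtain ⟨k, hk⟩ := Module.projective_lifting_property (g.restrictScalars R) η hg
  replace hk : ∀ q, g (k q) = η q := LinearMap.congr_fun hk
  -- the section of `g` sends `φ` to `∑ y i • k (φ (x i))`, which is `S`-linear by the Casimir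
  -- property
  refine Module.projective_def'.2 ⟨
    { toFun := fun φ => ∑ i, F.y i • k (φ (F.x i))
      map_add' := fun φ ψ => by simp [Finset.sum_add_distrib]
      map_smul' := fun s φ => F.casimir k (φ : S →ₗ[R] Q) s }, LinearMap.ext fun φ => ?_⟩
  refine CoinducedModule.ext fun x => ?_
  change g (∑ i, F.y i • k (φ (F.x i))) x = φ x
  conv_rhs => rw [← F.sum_smul_x x, map_sum]
  simp only [map_sum, map_smul, hk, CoinducedModule.sum_apply, CoinducedModule.smul_apply, hη]

end FrobeniusSystem

end Frobenius

/-! ### Comparison along a Frobenius extension -/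

section Comparison

variable {R S : Type u} [Ring R] [Ring S] [Module R S] [IsScalarTower R S S]

namespace FrobeniusSystem

variable [Module.Projective R S] {A B M : Type u}
  [AddCommGroup A] [Module R A] [Module S A] [IsScalarTower R S A]
  [AddCommGroup B] [Module R B] [Module S B] [IsScalarTower R S B]
  [AddCommGroup M] [Module R M] [Module S M] [IsScalarTower R S M]

/-- Links over `S` restrict to links over `R`, since `R`-linear maps into `Q` are `S`-linear maps
into the projective module `Hom_R(S, Q)`. -/
theorem projectiveLink_restrict (F : FrobeniusSystem R S)
    (h : ProjectiveLink S A B) : ProjectiveLink R A B := by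
  obtain ⟨P, f, g, hP, hf, hfg, hg, hex⟩ := h
  obtain ⟨_, _⟩ := exists_restrict R S P
  refine ⟨.of R P, f.restrictScalars R, g.restrictScalars R,
    Module.Projective.restrict_tower (S := S) (M := P), hf, hfg, hg, ?_⟩
  intro Q _ _ _ h
  obtain ⟨_, _⟩ := exists_restrict R S (CoinducedModule R S Q)
  have := F.projective_coinduced Q
  obtain ⟨k, hk⟩ := hex _ (CoinducedModule.adjoint h)
  refine ⟨CoinducedModule.eval Q ∘ₗ k.restrictScalars R, fun a => ?_⟩
  change k (f a) 1 = h a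
  rw [hk, CoinducedModule.adjoint_apply, one_smul]

theorem isGorensteinProjective_restrict (F : FrobeniusSystem R S)
    (h : IsGorensteinProjective S M) :
    IsGorensteinProjective R M := by
  refine isGorensteinProjective_of_class (fun A => ∃ (_ : Module S A) (_ : IsScalarTower R S A),
    IsGorensteinProjective S A) ?_ ?_ ⟨‹_›, ‹_›, h⟩
  · rintro A ⟨_, _, hA⟩
    obtain ⟨B, hB, hAB⟩ := hA.exists_next
    obtain ⟨_, _⟩ := exists_restrict R S B
    exact ⟨.of R B, ⟨inferInstanceAs (Module S B), inferInstanceAs (IsScalarTower R S B), hB⟩,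
      F.projectiveLink_restrict hAB⟩
  · rintro A ⟨_, _, hA⟩
    obtain ⟨B, hB, hBA⟩ := hA.exists_prev
    obtain ⟨_, _⟩ := exists_restrict R S B
    exact ⟨.of R B, ⟨inferInstanceAs (Module S B), inferInstanceAs (IsScalarTower R S B), hB⟩,
      F.projectiveLink_restrict hBA⟩

/-- If `M` embeds over `R` in a projective module `P` as in a complete resolution, then the adjoint
map embeds `M` over `S` in the projective module `Hom_R(S, P)`. -/
theorem exists_link_of_isGorensteinProjective_restrict (F : FrobeniusSystem R S)
    (h : IsGorensteinProjective R M) :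
    ∃ (N : ModuleCat.{u} S) (_ : Module R N) (_ : IsScalarTower R S N),
      IsGorensteinProjective R N ∧ ProjectiveLink S M N := by
  obtain ⟨_, -, P, f, _, hP, hf, -, -, hex⟩ := h.exists_next
  have hT : Module.Projective S (CoinducedModule R S P) := F.projective_coinduced P
  obtain ⟨_, _⟩ := exists_restrict R S (CoinducedModule R S P)
  have : Module.Projective R (CoinducedModule R S P) := .restrict_tower (S := S)
  let j : M →ₗ[S] CoinducedModule R S P := CoinducedModule.adjoint f
  have hj1 : ∀ m, j m 1 = f m := fun m => by
    rw [CoinducedModule.adjoint_apply, one_smul]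
  have hexj : (j.restrictScalars R).ExtendsToProjective := by
    intro Q _ _ _ φ
    obtain ⟨k, hk⟩ := hex Q φ
    exact ⟨k ∘ₗ CoinducedModule.eval P, fun m => (congrArg k (hj1 m)).trans (hk m)⟩
  obtain ⟨_, _⟩ := exists_restrict R S (CoinducedModule R S P ⧸ LinearMap.range j)
  let c := (LinearMap.range j).mkQ
  have hc : Surjective c := Submodule.mkQ_surjective _
  have hexact : Exact j c := LinearMap.exact_map_mkQ_range j
  have hGP : IsGorensteinProjective R (CoinducedModule R S P ⧸ LinearMap.range j) :=
    h.of_cokernel (j.restrictScalars R) (c.restrictScalars R) hexact hc hexj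
  refine ⟨.of S (CoinducedModule R S P ⧸ LinearMap.range j), ‹_›, ‹_›, hGP,
    .of S (CoinducedModule R S P), j, c, hT, fun x y hxy => hf ?_, hexact, hc,
    F.extendsToProjective hexj⟩
  rw [← hj1, hxy, hj1]

/-- The kernel of a free presentation over `S` is a link to the left, because the extension property
over `S` follows from that over `R`. -/
theorem exists_link_to_of_isGorensteinProjective_restrict (F : FrobeniusSystem R S)
    (h : IsGorensteinProjective R M) :
    ∃ (N : ModuleCat.{u} S) (_ : Module R N) (_ : IsScalarTower R S N),
      IsGorensteinProjective R N ∧ ProjectiveLink S N M := by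
  let p := Finsupp.linearCombination S (id : M → M)
  have hp : Surjective p := Finsupp.linearCombination_id_surjective S M
  have : Module.Projective R (M →₀ S) := .restrict_tower (S := S)
  obtain ⟨_, _⟩ := exists_restrict R S (LinearMap.ker p)
  have hexact := LinearMap.exact_subtype_ker_map p
  exact ⟨.of S (LinearMap.ker p), ‹_›, ‹_›,
    IsGorensteinProjective.of_kernel (.of_projective (M := M →₀ S)) h
      ((LinearMap.ker p).subtype.restrictScalars R) (p.restrictScalars R)
      Subtype.val_injective hexact hp,
    .of S (M →₀ S), (LinearMap.ker p).subtype, p, inferInstanceAs (Module.Projective S (M →₀ S)),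
    Subtype.val_injective, hexact, hp,
    F.extendsToProjective (h.extendsToProjective
      (i := (LinearMap.ker p).subtype.restrictScalars R) (p := p.restrictScalars R)
      Subtype.val_injective hexact hp)⟩

/-- Over a Frobenius extension, an `S`-module is Gorenstein projective exactly when its
underlying `R`-module is. -/
theorem isGorensteinProjective_iff (F : FrobeniusSystem R S) :
    IsGorensteinProjective S M ↔ IsGorensteinProjective R M := by
  refine ⟨F.isGorensteinProjective_restrict, fun h => isGorensteinProjective_of_class
    (fun A => ∃ (_ : Module R A) (_ : IsScalarTower R S A), IsGorensteinProjective R A)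
    ?_ ?_ ⟨‹_›, ‹_›, h⟩⟩
  · rintro A ⟨_, _, hA⟩
    obtain ⟨N, h1, h2, h3, h4⟩ := F.exists_link_of_isGorensteinProjective_restrict hA
    exact ⟨N, ⟨h1, h2, h3⟩, h4⟩
  · rintro A ⟨_, _, hA⟩
    obtain ⟨N, h1, h2, h3, h4⟩ := F.exists_link_to_of_isGorensteinProjective_restrict hA
    exact ⟨N, ⟨h1, h2, h3⟩, h4⟩

theorem hasGorensteinProjectiveResolution_iff (F : FrobeniusSystem R S)
    {n : ℕ} : HasGorensteinProjectiveResolution S M n ↔ HasGorensteinProjectiveResolution R M n := by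
  induction n generalizing M with
  | zero =>
    rw [HasGorensteinProjectiveResolution.zero_iff, HasGorensteinProjectiveResolution.zero_iff,
      F.isGorensteinProjective_iff]
  | succ n ih =>
    constructor
    · intro h
      obtain ⟨G, p, hG, hp, hK⟩ := h.uncons
      obtain ⟨_, _⟩ := exists_restrict R S G
      obtain ⟨_, _⟩ := exists_restrict R S (LinearMap.ker p)
      exact (ih.1 hK).cons (F.isGorensteinProjective_iff.1 hG)
        ((LinearMap.ker p).subtype.restrictScalars R) (p.restrictScalars R)
        Subtype.val_injective (LinearMap.exact_subtype_ker_map p) hp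
    · intro h
      let p := Finsupp.linearCombination S (id : M → M)
      have hp : Surjective p := Finsupp.linearCombination_id_surjective S M
      have : Module.Projective R (M →₀ S) := .restrict_tower (S := S)
      obtain ⟨_, _⟩ := exists_restrict R S (LinearMap.ker p)
      have hexact := LinearMap.exact_subtype_ker_map p
      have hK := h.kernel_projective ((LinearMap.ker p).subtype.restrictScalars R)
        (p.restrictScalars R) Subtype.val_injective hexact hp
      exact (ih.2 hK).cons (.of_projective (M := M →₀ S)) (LinearMap.ker p).subtype p
        Subtype.val_injective hexact hp

end FrobeniusSystem

end Comparison

theorem corollary5p11 {R S : Type u} [Ring R] [Ring S]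
    [IsNoetherianRing R] [IsNoetherianRing Rᵐᵒᵖ] [IsNoetherianRing S] [IsNoetherianRing Sᵐᵒᵖ]
    (l : R →+* S) (hl : IsFrobeniusExtension l)
    (M : Type u) [AddCommGroup M] [Module S M] [Module.Finite S M] :
    letI : Module R M := Module.compHom M l
    gorensteinProjectiveDimension S M = gorensteinProjectiveDimension R M := by
  let _ : Module R S := Module.compHom S l
  let _ : Module R M := Module.compHom M l
  have : IsScalarTower R S M := ⟨fun r s m => mul_smul (l r) s m⟩
  obtain ⟨_, ⟨F⟩⟩ := exists_frobeniusSystem l hl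
  have : Module.Projective R S := hl.2.1
  simp only [gorensteinProjectiveDimension, F.hasGorensteinProjectiveResolution_iff (M := M)]
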